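/- Dynamic pricing with $K$ valuations. An instance consists of values $0\le v_1<\dots<v_K\le 1$ and probabilities $p_1,\dots,p_K>0$ with $\sum_i p_i=1$. Buyers' valuations $V_1,V_2,\dots$ are i.i.d. with $\mathbb P(V_t=v_i)=p_i$. In round $t$ the seller posts a price $X_t\in[0,1]$, then observes only the bit $Z_t=\mathbb I\{V_t\ge X_t\}$ and earns $r_t(X_t)$, where $r_t(x)=x\,\mathbb I\{V_t\ge x\}$. A deterministic strategy chooses $X_t$ as an arbitrary function of $X_1,Z_1,\dots,X_{t-1},Z_{t-1}$; a (randomized) pricing strategy is a probability distribution over deterministic strategies, independent of the valuations. The regret over $T$ rounds is $$R_T=\max_{x\in[0,1]}\mathbb E\Big[\sum_{t=1}^T r_t(x)-\sum_{t=1}^T r_t(X_t)\Big].$$ Theorem. For every integer $K\ge 3$ and every integer $T\ge K^3$ there are values $0\le v_1<\dots<v_K\le1$ and a finite nonempty family $p^{(1)},\dots,p^{(m)}$ of strictly positive probability vectors on $\{v_1,\dots,v_K\}$, none of them depending on the strategy, such that the following holds for every (possibly randomized) pricing strategy: writing $R_T^{(j)}$ for the regret of the strategy on the instance $(v,p^{(j)})$,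 $$\max_{1\le j\le m}R_T^{(j)}\ \ge\ \frac1m\sum_{j=1}^m R_T^{(j)}\ \ge\ \frac{1}{375}\sqrt{KT}.$$ In particular, with $v$ fixed in advance, every strategy has regret at least $\frac1{375}\sqrt{KT}=\Omega(\sqrt{KT})$ on some instance with valuations $v_1,\dots,v_K$. -/

import Mathlib

open MeasureTheory

namespace DynamicPricing

noncomputable section

/-- Prices and valuations live in the unit interval `[0,1]`. -/
abbrev Price : Type := Set.Icc (0 : ℝ) 1

/-- An instance of the posted price problem with `K` valuations: distinct values
`v₁ < ⋯ < v_K` in `[0,1]` and their (strictly positive) probabilities `p₁, …, p_K`. -/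
structure Instance (K : ℕ) where
  v : Fin K → Price
  p : Fin K → ℝ
  v_strictMono : StrictMono v
  p_pos : ∀ i, 0 < p i
  p_sum : ∑ i, p i = 1

/-- Revenue of posting price `x` to a buyer with valuation `w`: `x · 𝕀{w ≥ x}`. -/
def revenue (x w : Price) : ℝ := if (x : ℝ) ≤ w then x else 0

/-- A deterministic seller: an arbitrary map assigning to each finite history
`(X₁, Z₁), …, (Xₜ, Zₜ)` (in chronological order) of posted prices and observed feedback bits
the next price. The restriction of `post` to the lists of length `t` is the `(t+1)`-st function
of the seller. -/
structure DeterministicSeller where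
  post : List (Price × Bool) → Price

namespace DeterministicSeller

/-- The history of the first `t` rounds when the buyers' valuations are `V`.
In each round, `X` is the price posted after the history so far,
and the feedback is the bit `𝕀{V ≥ X}`. -/
def history (f : DeterministicSeller) {T : ℕ} (V : Fin T → Price) :
    (t : ℕ) → t ≤ T → List (Price × Bool)
  | 0, _ => []
  | t + 1, h =>
      let past := f.history V t (Nat.le_of_succ_le h)
      past ++ [(f.post past, decide ((f.post past : ℝ) ≤ V ⟨t, h⟩))]

/-- The price posted in round `t` when the buyers' valuations are `V`. -/
def price (f : DeterministicSeller) {T : ℕ} (V : Fin T → Price) (t : Fin T) : Price :=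
  f.post (f.history V t t.isLt.le)

/-- The coarsest σ-algebra on deterministic sellers for which every price posted against a given
sequence of valuations is a random variable. -/
instance : MeasurableSpace DeterministicSeller :=
  ⨆ (T : ℕ) (V : Fin T → Price) (t : Fin T),
    MeasurableSpace.comap (fun f : DeterministicSeller => f.price V t) inferInstance

end DeterministicSeller

/-- Expectation of `g(V₁, …, V_T)`, where `V₁, …, V_T` are i.i.d. with `P(V_t = v_i) = p_i`. -/
def Instance.expect {K : ℕ} (I : Instance K) {T : ℕ} (g : (Fin T → Price) → ℝ) : ℝ :=
  ∑ i : Fin T → Fin K, (∏ t, I.p (i t)) * g (fun t => I.v (i t))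

/-- Expected difference, over `T` rounds, between the revenue of constantly posting `x` and the
revenue of the randomized seller `S`, a probability measure on deterministic sellers.
The seller's randomness is independent of the valuations. -/
def regretAgainst {K : ℕ} (I : Instance K) (T : ℕ) (S : Measure DeterministicSeller)
    (x : Price) : ℝ :=
  ∫ f, I.expect (fun V : Fin T → Price =>
    ∑ t, revenue x (V t) - ∑ t, revenue (f.price V t) (V t)) ∂S

/-- The regret `R_T`: the supremum over all fixed prices `x ∈ [0,1]`. -/
def regret {K : ℕ} (I : Instance K) (T : ℕ) (S : Measure DeterministicSeller) : ℝ :=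
  ⨆ x : Price, regretAgainst I T S x

end

end DynamicPricing

/-! Needle in a haystack. With `n = K - 1`, the values are spaced so that under a base distribution
every value, used as a price, earns exactly 1/4. Instance `j` moves mass `ε` from value `j` to value
`j + 1`. This raises the demand by `ε` on the cell between these two values and nowhere else, so a
round outside cell `j` earns at most 1/4 and reveals nothing about the shift, while posting value `j
+ 1` earns at least `ε / 3` more (`expect_regret_shiftedInstance_ge`).

Let `N j` be the number of rounds spent in cell `j`. Cells are disjoint, so under the base
distribution the expectations of the `N j` sum to at most `T`. The divergence between base and
instance `j` is at most `16/3 * ε ^ 2` times the expected `N j`, so the Donsker–Varadhan inequality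
(`one_sub_stepOp_pow_totalWeight_ge`) carries a small expected `N j` from the base over to instance
`j`. With `ε` of order `√(K / T)`, a typical cell is missed in a constant fraction of the rounds,
for an average regret of order `ε * T`.

Expectations over interactions are powers of the one-round operator `stepOp`, so each probabilistic
estimate is an induction on rounds. Randomized sellers follow by integrating the deterministic bound
on the sum over `j`. -/

namespace DynamicPricing

/-! ### Histories and the one-round expectation operator -/

/-- The probability that a buyer accepts the price `x`. -/
noncomputable def Instance.demand {K : ℕ} (I : Instance K) (x : Price) : ℝ :=
  ∑ i, I.p i * if x ≤ I.v i then 1 else 0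

/-- Total revenue recorded in a history. -/
noncomputable def totalRevenue (h : List (Price × Bool)) : ℝ :=
  (h.map fun e => if e.2 then (e.1 : ℝ) else 0).sum

/-- Total weight `c` of the prices recorded in a history. -/
noncomputable def totalWeight (c : Price → ℝ) (h : List (Price × Bool)) : ℝ :=
  (h.map fun e => c e.1).sum

@[simp] lemma totalRevenue_nil : totalRevenue [] = 0 := by simp [totalRevenue]

@[simp] lemma totalWeight_nil (c : Price → ℝ) : totalWeight c [] = 0 := by simp [totalWeight]

lemma totalRevenue_append (h : List (Price × Bool)) (x : Price) (z : Bool) :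
    totalRevenue (h ++ [(x, z)]) = totalRevenue h + if z then (x : ℝ) else 0 := by
  simp [totalRevenue]

lemma totalWeight_append (c : Price → ℝ) (h : List (Price × Bool)) (x : Price) (z : Bool) :
    totalWeight c (h ++ [(x, z)]) = totalWeight c h + c x := by
  simp [totalWeight]

lemma totalWeight_nonneg {c : Price → ℝ} (hc : ∀ x, 0 ≤ c x) (h : List (Price × Bool)) :
    0 ≤ totalWeight c h := by
  apply List.sum_nonneg
  intro a ha
  obtain ⟨e, -, rfl⟩ := List.mem_map.1 ha
  exact hc _

lemma totalWeight_le_length {c : Price → ℝ} (hc : ∀ x, c x ≤ 1) (h : List (Price × Bool)) :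
    totalWeight c h ≤ h.length := by
  induction h with
  | nil => simp
  | cons e h ih =>
    simp only [totalWeight, List.map_cons, List.sum_cons, List.length_cons] at ih ⊢
    push_cast
    linarith [hc e.1]

/-- The conditional expectation, given the history, of a function of the history one round later,
when the price `x` is accepted with probability `d x`. -/
def stepOp (f : DeterministicSeller) (d : Price → ℝ) :
    Module.End ℝ (List (Price × Bool) → ℝ) where
  toFun G h := d (f.post h) * G (h ++ [(f.post h, true)])
    + (1 - d (f.post h)) * G (h ++ [(f.post h, false)])
  map_add' G G' := by
    funext h
    simp only [Pi.add_apply]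
    ring
  map_smul' a G := by
    funext h
    simp only [Pi.smul_apply, smul_eq_mul, RingHom.id_apply]
    ring

lemma stepOp_apply (f : DeterministicSeller) (d : Price → ℝ) (G : List (Price × Bool) → ℝ)
    (h : List (Price × Bool)) :
    stepOp f d G h = d (f.post h) * G (h ++ [(f.post h, true)])
      + (1 - d (f.post h)) * G (h ++ [(f.post h, false)]) := rfl

lemma stepOp_pow_succ (f : DeterministicSeller) (d : Price → ℝ) (G : List (Price × Bool) → ℝ)
    (t : ℕ) : (stepOp f d ^ (t + 1)) G = stepOp f d ((stepOp f d ^ t) G) := by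
  rw [pow_succ', Module.End.mul_apply]

lemma stepOp_pow_succ' (f : DeterministicSeller) (d : Price → ℝ) (G : List (Price × Bool) → ℝ)
    (t : ℕ) : (stepOp f d ^ (t + 1)) G = (stepOp f d ^ t) (stepOp f d G) := by
  rw [pow_succ, Module.End.mul_apply]

lemma stepOp_pow_const (f : DeterministicSeller) (d : Price → ℝ) (a : ℝ) (t : ℕ) :
    (stepOp f d ^ t) (fun _ => a) = fun _ => a := by
  induction t with
  | zero => rfl
  | succ t ih =>
    rw [stepOp_pow_succ, ih]
    funext h
    rw [stepOp_apply]
    ring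

lemma stepOp_totalWeight (f : DeterministicSeller) (d c : Price → ℝ) (h : List (Price × Bool)) :
    stepOp f d (totalWeight c) h = totalWeight c h + c (f.post h) := by
  rw [stepOp_apply, totalWeight_append, totalWeight_append]
  ring

lemma stepOp_totalRevenue (f : DeterministicSeller) (d : Price → ℝ) (h : List (Price × Bool)) :
    stepOp f d totalRevenue h = totalRevenue h + f.post h * d (f.post h) := by
  rw [stepOp_apply, totalRevenue_append, totalRevenue_append]
  simp only [if_true, Bool.false_eq_true, if_false]
  ring

lemma stepOp_mono (f : DeterministicSeller) {d : Price → ℝ} (h0 : ∀ x, 0 ≤ d x)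
    (h1 : ∀ x, d x ≤ 1) {G G' : List (Price × Bool) → ℝ} (h : List (Price × Bool))
    (hG : ∀ e, G (h ++ [e]) ≤ G' (h ++ [e])) : stepOp f d G h ≤ stepOp f d G' h := by
  rw [stepOp_apply, stepOp_apply]
  have := sub_nonneg.2 (h1 (f.post h))
  have := h0 (f.post h)
  gcongr <;> exact hG _

lemma stepOp_pow_mono (f : DeterministicSeller) {d : Price → ℝ} (h0 : ∀ x, 0 ≤ d x)
    (h1 : ∀ x, d x ≤ 1) {G G' : List (Price × Bool) → ℝ} (t : ℕ) (h : List (Price × Bool))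
    (hG : ∀ h', h'.length = h.length + t → G h' ≤ G' h') :
    (stepOp f d ^ t) G h ≤ (stepOp f d ^ t) G' h := by
  induction t generalizing h with
  | zero => exact hG h rfl
  | succ t ih =>
    rw [stepOp_pow_succ, stepOp_pow_succ]
    refine stepOp_mono f h0 h1 h fun e => ih _ fun h' hh => hG h' ?_
    simp at hh
    omega

/-- Drift bound: a function of the history with conditional increments at most `a` grows by at most
`t * a` in expectation. -/
lemma stepOp_pow_le_add_mul (f : DeterministicSeller) {d : Price → ℝ} (h0 : ∀ x, 0 ≤ d x)
    (h1 : ∀ x, d x ≤ 1) {G : List (Price × Bool) → ℝ} {a : ℝ}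
    (hG : ∀ h, stepOp f d G h ≤ G h + a) (t : ℕ) (h : List (Price × Bool)) :
    (stepOp f d ^ t) G h ≤ G h + t * a := by
  induction t with
  | zero => simp
  | succ t ih =>
    rw [stepOp_pow_succ']
    have hm := stepOp_pow_mono f h0 h1 (G' := G + fun _ => a) t h fun h' _ => hG h'
    rw [map_add, stepOp_pow_const, Pi.add_apply] at hm
    push_cast
    linarith

lemma stepOp_pow_pos (f : DeterministicSeller) {d : Price → ℝ} (h0 : ∀ x, 0 ≤ d x)
    (h1 : ∀ x, d x ≤ 1) {G : List (Price × Bool) → ℝ} (hG : ∀ h, 0 < G h) (t : ℕ)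
    (h : List (Price × Bool)) : 0 < (stepOp f d ^ t) G h := by
  induction t generalizing h with
  | zero => exact hG h
  | succ t ih =>
    rw [stepOp_pow_succ, stepOp_apply]
    have ha := ih (h ++ [(f.post h, true)])
    have hb := ih (h ++ [(f.post h, false)])
    rcases (h0 (f.post h)).eq_or_lt with h | h
    · rw [← h]
      linarith
    · have := mul_nonneg (sub_nonneg.2 (h1 (f.post ‹_›))) hb.le
      have := mul_pos h ha
      linarith

/-! ### Expectations over i.i.d. valuations as powers of `stepOp` -/

lemma history_init (f : DeterministicSeller) {T : ℕ} (V : Fin (T + 1) → Price) (t : ℕ)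
    (h : t ≤ T) : f.history V t (h.trans T.le_succ) = f.history (Fin.init V) t h := by
  induction t with
  | zero => rfl
  | succ t ih =>
    simp only [DeterministicSeller.history]
    rw [ih (Nat.le_of_succ_le h)]
    rfl

lemma sum_revenue_price (f : DeterministicSeller) {T : ℕ} (V : Fin T → Price) :
    ∑ t, revenue (f.price V t) (V t) = totalRevenue (f.history V T le_rfl) := by
  induction T with
  | zero => simp [DeterministicSeller.history]
  | succ T ih =>
    rw [Fin.sum_univ_castSucc]
    have hp : ∀ t : Fin T, f.price V t.castSucc = f.price (Fin.init V) t := fun t => by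
      unfold DeterministicSeller.price
      exact congrArg f.post (history_init f V t t.isLt.le)
    have hl : f.price V (Fin.last T) = f.post (f.history V T T.le_succ) := rfl
    have hs := ih (Fin.init V)
    simp only [Fin.init] at hs
    simp only [hp, hl, DeterministicSeller.history, totalRevenue_append]
    rw [hs, history_init f V T le_rfl]
    congr 1
    simp [revenue, Fin.last]

/-- The last valuation is independent of the past and enters the history only through a bit that
equals one with probability `I.demand` at the posted price. Summing it out first applies `stepOp`
once. -/
lemma expect_history {K : ℕ} (I : Instance K) (f : DeterministicSeller) (T : ℕ)
    (G : List (Price × Bool) → ℝ) :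
    I.expect (fun V : Fin T → Price => G (f.history V T le_rfl))
      = (stepOp f I.demand ^ T) G [] := by
  induction T generalizing G with
  | zero => simp [Instance.expect, DeterministicSeller.history]
  | succ T ih =>
    rw [stepOp_pow_succ', ← ih]
    unfold Instance.expect
    rw [← (Fin.snocEquiv fun _ : Fin (T + 1) => Fin K).sum_comp, Fintype.sum_prod_type_right]
    refine Finset.sum_congr rfl fun i _ => ?_
    have key : ∀ a : Fin K,
        f.history (fun t => I.v ((Fin.snocEquiv fun _ : Fin (T + 1) => Fin K) (a, i) t))
          (T + 1) le_rfl = f.history (fun t => I.v (i t)) T le_rfl ++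
          [(f.post (f.history (fun t => I.v (i t)) T le_rfl),
            decide (f.post (f.history (fun t => I.v (i t)) T le_rfl) ≤ I.v a))] := by
      intro a
      simp only [DeterministicSeller.history]
      rw [history_init f _ T le_rfl]
      have : (Fin.init fun t => I.v ((Fin.snocEquiv fun _ : Fin (T + 1) => Fin K) (a, i) t))
          = fun t => I.v (i t) := by
        funext t
        simp [Fin.init, Fin.snocEquiv]
      rw [this]
      have hl : (⟨T, Nat.lt_succ_self T⟩ : Fin (T + 1)) = Fin.last T := rfl
      simp [Fin.snocEquiv, hl]
    simp only [key, Fin.prod_univ_castSucc]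
    simp only [Fin.snocEquiv, Equiv.coe_fn_mk, Fin.snoc_castSucc, Fin.snoc_last]
    rw [stepOp_apply, Instance.demand]
    generalize f.history (fun t => I.v (i t)) T le_rfl = h
    simp only [mul_assoc]
    rw [← Finset.mul_sum]
    congr 1
    have hG : ∀ a, I.p a * G (h ++ [(f.post h, decide (f.post h ≤ I.v a))])
        = I.p a * (if f.post h ≤ I.v a then 1 else 0) * G (h ++ [(f.post h, true)])
          + (I.p a - I.p a * (if f.post h ≤ I.v a then 1 else 0))
            * G (h ++ [(f.post h, false)]) := by
      intro a
      split_ifs with hx <;> simp [hx]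
    simp only [hG]
    rw [Finset.sum_add_distrib, ← Finset.sum_mul, ← Finset.sum_mul, Finset.sum_sub_distrib, I.p_sum]

lemma expect_sub {K : ℕ} (I : Instance K) {T : ℕ} (g g' : (Fin T → Price) → ℝ) :
    I.expect (fun V => g V - g' V) = I.expect g - I.expect g' := by
  simp only [Instance.expect, mul_sub, Finset.sum_sub_distrib]

lemma expect_revenue_const {K : ℕ} (I : Instance K) (T : ℕ) (x : Price) :
    I.expect (fun V : Fin T → Price => ∑ t, revenue x (V t)) = T * (x * I.demand x) := by
  set f : DeterministicSeller := ⟨fun _ => x⟩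
  have h1 : (fun V : Fin T → Price => ∑ t, revenue x (V t))
      = fun V => totalRevenue (f.history V T le_rfl) := by
    funext V
    rw [← sum_revenue_price]
    rfl
  rw [h1, expect_history]
  have h2 : ∀ (t : ℕ) (h : List (Price × Bool)),
      (stepOp f I.demand ^ t) totalRevenue h = totalRevenue h + t * (x * I.demand x) := by
    intro t
    induction t with
    | zero => simp
    | succ t ih =>
      intro h
      rw [stepOp_pow_succ, stepOp_apply, ih, ih, totalRevenue_append, totalRevenue_append]
      simp [f]
      ring
  simpa using h2 T []

lemma expect_regret {K : ℕ} (I : Instance K) (f : DeterministicSeller) (T : ℕ) (x : Price) :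
    I.expect (fun V : Fin T → Price =>
      ∑ t, revenue x (V t) - ∑ t, revenue (f.price V t) (V t))
      = T * (x * I.demand x) - (stepOp f I.demand ^ T) totalRevenue [] := by
  rw [expect_sub, expect_revenue_const]
  simp only [sum_revenue_price]
  rw [expect_history]

/-! ### Change of measure -/

lemma mul_log_add_mul_log_le_self {p a b : ℝ} (h0 : 0 ≤ p) (h1 : p ≤ 1) (ha : 0 < a)
    (hb : 0 < b) :
    p * Real.log a + (1 - p) * Real.log b ≤ Real.log (p * a + (1 - p) * b) := by
  have := (strictConcaveOn_log_Ioi.concaveOn).2 (Set.mem_Ioi.2 ha) (Set.mem_Ioi.2 hb) h0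
    (sub_nonneg.2 h1) (by ring)
  simpa using this

/-- A two-point Donsker–Varadhan inequality, with the Kullback–Leibler divergence bounded by the
`χ²`-divergence. -/
lemma mul_log_add_mul_log_le {p q a b : ℝ} (p0 : 0 < p) (p1 : p < 1) (q0 : 0 < q) (q1 : q < 1)
    (ha : 0 < a) (hb : 0 < b) :
    p * Real.log a + (1 - p) * Real.log b
      ≤ (p - q) ^ 2 / (q * (1 - q)) + Real.log (q * a + (1 - q) * b) := by
  have q1' := sub_pos.2 q1
  have p1' := sub_pos.2 p1
  have hm : 0 < q * a + (1 - q) * b := by positivity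
  set m := q * a + (1 - q) * b
  -- Both summands come from `log y ≤ y - 1`, at `q * a / (m * p)` and at `p / q`. Over the two
  -- outcomes the middle terms cancel and the last ones add up to the `χ²`-divergence.
  have key : ∀ {p q a : ℝ}, 0 < p → 0 < q → 0 < a →
      p * Real.log a ≤ p * Real.log m + (q * a / m - p) + p * (p / q - 1) := by
    intro p q a hp hq ha
    have h1 := Real.log_le_sub_one_of_pos (show 0 < q * a / (m * p) by positivity)
    have h2 := Real.log_le_sub_one_of_pos (show 0 < p / q by positivity)
    rw [Real.log_div (by positivity) (by positivity), Real.log_mul hq.ne' ha.ne',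
      Real.log_mul hm.ne' hp.ne'] at h1
    rw [Real.log_div hp.ne' hq.ne'] at h2
    have h3 := mul_le_mul_of_nonneg_left (add_le_add h1 h2) hp.le
    have h4 : p * (q * a / (m * p) - 1 + (p / q - 1)) = q * a / m - p + p * (p / q - 1) := by
      field_simp
    linarith
  have h1 := key p0 q0 ha
  have h2 := key p1' q1' hb
  have h3 : q * a / m + (1 - q) * b / m = 1 := by
    rw [← add_div, div_self hm.ne']
  have h4 : p * (p / q - 1) + (1 - p) * ((1 - p) / (1 - q) - 1)
      = (p - q) ^ 2 / (q * (1 - q)) := by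
    field_simp
    ring
  linarith

/-- The Donsker–Varadhan inequality along the interaction of a seller with two demand functions,
whose divergence at the price `x` is at most `κ * c x`. -/
lemma stepOp_pow_log_le (f : DeterministicSeller) {d₀ d₁ c : Price → ℝ} {κ : ℝ}
    (h0 : ∀ x, 0 ≤ d₀ x) (h1 : ∀ x, d₀ x ≤ 1) (h0' : ∀ x, 0 ≤ d₁ x) (h1' : ∀ x, d₁ x ≤ 1)
    (hd : ∀ x a b, 0 < a → 0 < b → d₀ x * Real.log a + (1 - d₀ x) * Real.log b
      ≤ κ * c x + Real.log (d₁ x * a + (1 - d₁ x) * b))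
    {φ : List (Price × Bool) → ℝ} (hφ : ∀ h, 0 < φ h) (t : ℕ) (h : List (Price × Bool)) :
    (stepOp f d₀ ^ t) (fun h => Real.log (φ h)) h + κ * totalWeight c h
      ≤ Real.log ((stepOp f d₁ ^ t) φ h) + κ * (stepOp f d₀ ^ t) (totalWeight c) h := by
  -- Here `t` counts the remaining rounds. The weight already recorded in `h` is added on the left
  -- because the expected weight on the right includes it.
  induction t generalizing h with
  | zero => simp
  | succ t ih =>
    set x := f.post h with hx
    have ht := ih (h ++ [(x, true)])
    have hf := ih (h ++ [(x, false)])
    rw [totalWeight_append] at ht hf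
    have hl := hd x _ _ (stepOp_pow_pos f h0' h1' hφ t (h ++ [(x, true)]))
      (stepOp_pow_pos f h0' h1' hφ t (h ++ [(x, false)]))
    have ht' := mul_le_mul_of_nonneg_left ht (h0 x)
    have hf' := mul_le_mul_of_nonneg_left hf (sub_nonneg.2 (h1 x))
    simp only [stepOp_pow_succ, stepOp_apply, ← hx]
    linarith

/-- If two demand functions differ little at the prices marked by `c`, then a seller who rarely
posts marked prices under `d₀` does not post them too often under `d₁`. -/
lemma one_sub_stepOp_pow_totalWeight_ge (f : DeterministicSeller) {d₀ d₁ c : Price → ℝ} {κ : ℝ}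
    (h0 : ∀ x, 0 ≤ d₀ x) (h1 : ∀ x, d₀ x ≤ 1) (h0' : ∀ x, 0 ≤ d₁ x) (h1' : ∀ x, d₁ x ≤ 1)
    (c0 : ∀ x, 0 ≤ c x) (c1 : ∀ x, c x ≤ 1)
    (hd : ∀ x a b, 0 < a → 0 < b → d₀ x * Real.log a + (1 - d₀ x) * Real.log b
      ≤ κ * c x + Real.log (d₁ x * a + (1 - d₁ x) * b))
    {T : ℕ} (hT : 0 < T) {l : ℝ} (l0 : 0 < l) (l1 : l ≤ 1) :
    (1 - (stepOp f d₀ ^ T) (totalWeight c) [] / T) - l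
        - κ / l * (stepOp f d₀ ^ T) (totalWeight c) []
      ≤ 1 - (stepOp f d₁ ^ T) (totalWeight c) [] / T := by
  have hT' : (0 : ℝ) < T := by exact_mod_cast hT
  -- Exponential tilt of the fraction of unmarked rounds, with temperature `l`.
  have main := stepOp_pow_log_le f h0 h1 h0' h1' hd
    (φ := fun h => Real.exp (l * (1 - totalWeight c h / T))) (fun h => Real.exp_pos _) T []
  have affine : ∀ (d : Price → ℝ) (a b : ℝ), (stepOp f d ^ T) (fun h => a + b * totalWeight c h) []
      = a + b * (stepOp f d ^ T) (totalWeight c) [] := by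
    intro d a b
    have : (fun h => a + b * totalWeight c h) = (fun _ => a) + b • totalWeight c := rfl
    rw [this, map_add, map_smul, stepOp_pow_const]
    rfl
  have e0 : (fun h => Real.log (Real.exp (l * (1 - totalWeight c h / T))))
      = fun h => l + (-(l / T)) * totalWeight c h := by
    funext h
    rw [Real.log_exp]
    ring
  rw [e0, affine, totalWeight_nil] at main
  have up : (stepOp f d₁ ^ T) (fun h => Real.exp (l * (1 - totalWeight c h / T))) []
      ≤ (stepOp f d₁ ^ T) (fun h => (1 + l + l ^ 2) + (-(l / T)) * totalWeight c h) [] := by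
    refine stepOp_pow_mono f h0' h1' T [] fun h hh => ?_
    have w0 := totalWeight_nonneg c0 h
    have w1 := totalWeight_le_length c1 h
    rw [hh] at w1
    simp only [List.length_nil, zero_add] at w1
    have s0 : 0 ≤ 1 - totalWeight c h / T := sub_nonneg.2 ((div_le_one hT').2 w1)
    have s1 : 1 - totalWeight c h / T ≤ 1 := sub_le_self _ (by positivity)
    set s := 1 - totalWeight c h / T with hs
    have y0 : 0 ≤ l * s := by positivity
    have y1 : l * s ≤ l := mul_le_of_le_one_right l0.le s1
    -- `exp y ≤ 1 + y + y ^ 2`, valid since `y ≤ l ≤ 1`. After division by `l`, the quadratic term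
    -- costs the `- l` in the conclusion.
    have hexp := Real.abs_exp_sub_one_sub_id_le (x := l * s) (by
      rw [abs_of_nonneg y0]
      linarith)
    have h2 := (abs_le.1 hexp).2
    have h3 : (l * s) ^ 2 ≤ l ^ 2 := by gcongr
    have h4 : (1 + l + l ^ 2) + (-(l / T)) * totalWeight c h = 1 + l ^ 2 + l * s := by
      rw [hs]
      ring
    rw [h4]
    linarith
  rw [affine] at up
  have pos := stepOp_pow_pos f h0' h1'
    (G := fun h => Real.exp (l * (1 - totalWeight c h / T))) (fun h => Real.exp_pos _) T []
  have hlog := Real.log_le_sub_one_of_pos pos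
  have fin := mul_le_mul_of_nonneg_left (main.trans (add_le_add_left
    (hlog.trans (sub_le_sub_right up 1)) _)) (inv_nonneg.2 l0.le)
  have e1 : ∀ a, l⁻¹ * (l + -(l / T) * a + κ * 0) = 1 - a / T := by
    intro a
    field_simp
    ring
  have e2 : ∀ a b, l⁻¹ * ((1 + l + l ^ 2) + -(l / T) * a - 1 + κ * b)
      = 1 - a / T + l + κ / l * b := by
    intro a b
    field_simp
    ring
  rw [e1, e2] at fin
  linarith

/-! ### The base distribution and the grid of values -/

/-- The probability, under the base distribution on `n + 1` values, of a valuation at least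
as large as the `i`-th value. -/
noncomputable def baseTail (n i : ℕ) : ℝ :=
  if i = 0 then 1 else if i ≤ n then 3 / 4 - i / (2 * (n + 1)) else 0

lemma baseTail_zero (n : ℕ) : baseTail n 0 = 1 := by simp [baseTail]

lemma baseTail_of_lt {n i : ℕ} (h : n < i) : baseTail n i = 0 := by
  rw [baseTail, if_neg (by omega), if_neg (by omega)]

lemma baseTail_of_le {n i : ℕ} (h0 : 0 < i) (h : i ≤ n) :
    baseTail n i = 3 / 4 - i / (2 * (n + 1)) := by
  rw [baseTail, if_neg (by omega), if_pos h]

lemma baseTail_ge {n i : ℕ} (h : i ≤ n) : 1 / 4 ≤ baseTail n i := by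
  rcases Nat.eq_zero_or_pos i with rfl | h0
  · norm_num [baseTail_zero]
  · rw [baseTail_of_le h0 h]
    have : (i : ℝ) / (2 * (n + 1)) ≤ 1 / 2 := by
      rw [div_le_iff₀ (by positivity)]
      have : (i : ℝ) ≤ n := by exact_mod_cast h
      linarith
    linarith

lemma baseTail_le {n i : ℕ} (h0 : 0 < i) (h : i ≤ n) :
    baseTail n i ≤ 3 / 4 - 1 / (2 * (n + 1)) := by
  rw [baseTail_of_le h0 h]
  have : (1 : ℝ) ≤ i := by exact_mod_cast h0
  gcongr

/-- Lower bound on each base mass; it leaves room to remove `ε` from any value. -/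
lemma baseTail_sub_ge {n i : ℕ} (h : i ≤ n) :
    1 / (2 * ((n : ℝ) + 1)) ≤ baseTail n i - baseTail n (i + 1) := by
  have hn : 1 / (2 * ((n : ℝ) + 1)) ≤ 1 / 2 := by
    gcongr
    have : (0 : ℝ) ≤ n := by positivity
    linarith
  rcases Nat.eq_zero_or_pos i with rfl | h0
  · rcases Nat.eq_zero_or_pos n with rfl | hn0
    · norm_num [baseTail_zero, baseTail_of_lt]
    · rw [baseTail_zero, baseTail_of_le (by omega) (by omega)]
      simp only [zero_add, Nat.cast_one]
      have : 1 / (2 * ((n : ℝ) + 1)) > 0 := by positivity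
      have : (1 : ℝ) ≤ n := by exact_mod_cast hn0
      have : 1 / (2 * ((n : ℝ) + 1)) ≤ 1 / 4 := by
        gcongr
        linarith
      linarith
  · rcases h.eq_or_lt with rfl | h
    · rw [baseTail_of_le h0 le_rfl, baseTail_of_lt (Nat.lt_succ_self _)]
      have : (i : ℝ) / (2 * (i + 1)) = 1 / 2 - 1 / (2 * (i + 1)) := by
        field_simp
        ring
      have : 1 / (2 * ((i : ℝ) + 1)) > 0 := by positivity
      linarith
    · rw [baseTail_of_le h0 h.le, baseTail_of_le (by omega) h]
      push_cast
      apply le_of_eq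
      field_simp
      ring

/-- The values, chosen such that all of them have the same expected revenue `1 / 4` under the
base distribution. -/
noncomputable def gridValue (n : ℕ) (i : Fin (n + 1)) : Price :=
  ⟨1 / (4 * baseTail n i), by
    have := baseTail_ge (Nat.lt_succ_iff.1 i.isLt)
    refine ⟨by positivity, ?_⟩
    rw [div_le_one (by positivity)]
    linarith⟩

lemma gridValue_mul_baseTail {n : ℕ} (i : Fin (n + 1)) :
    (gridValue n i : ℝ) * baseTail n i = 1 / 4 := by
  have : 0 < baseTail n i := lt_of_lt_of_le (by norm_num) (baseTail_ge (Nat.lt_succ_iff.1 i.isLt))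
  simp only [gridValue]
  field_simp

lemma gridValue_strictMono (n : ℕ) : StrictMono (gridValue n) := by
  rw [Fin.strictMono_iff_lt_succ]
  intro i
  have h1 : 1 / 4 ≤ baseTail n (i + 1) := baseTail_ge i.isLt
  have h2 := baseTail_sub_ge (n := n) (i := i) i.isLt.le
  have h3 : (0 : ℝ) < 1 / (2 * ((n : ℝ) + 1)) := by positivity
  change (1 / (4 * baseTail n i) : ℝ) < 1 / (4 * baseTail n (i + 1))
  gcongr
  linarith

lemma gridValue_succ_ge {n : ℕ} (j : Fin n) : 1 / 3 ≤ (gridValue n j.succ : ℝ) := by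
  have h1 := baseTail_ge (n := n) (i := j + 1) j.isLt
  have h2 := baseTail_le (n := n) (i := j + 1) (by omega) j.isLt
  have h3 : (0 : ℝ) < 1 / (2 * ((n : ℝ) + 1)) := by positivity
  simp only [gridValue, Fin.val_succ]
  gcongr
  linarith

/-- Only the first value at or above a price matters for its demand; `k = n + 1` covers prices above
all values. -/
lemma exists_le_gridValue_iff (n : ℕ) (x : Price) :
    ∃ k ≤ n + 1, ∀ i : Fin (n + 1), x ≤ gridValue n i ↔ k ≤ i := by
  classical
  have hex : ∃ k : ℕ, ∀ i : Fin (n + 1), k ≤ i → x ≤ gridValue n i :=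
    ⟨n + 1, fun i hi => absurd i.isLt (by omega)⟩
  refine ⟨Nat.find hex, Nat.find_min' hex fun i hi => absurd i.isLt (by omega), fun i =>
    ⟨fun hx => Nat.find_min' hex fun i' hi => hx.trans ?_, Nat.find_spec hex i⟩⟩
  exact (gridValue_strictMono n).monotone hi

/-- The demand function of the base distribution. -/
noncomputable def baseDemand (n : ℕ) (x : Price) : ℝ :=
  ∑ i : Fin (n + 1), (baseTail n i - baseTail n (i + 1)) * if x ≤ gridValue n i then 1 else 0

lemma sum_range_sub_mul_ite (a : ℕ → ℝ) {k m : ℕ} (h : k ≤ m) :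
    ∑ i ∈ Finset.range m, (a i - a (i + 1)) * (if k ≤ i then 1 else 0) = a k - a m := by
  induction m, h using Nat.le_induction with
  | base =>
    rw [sub_self]
    refine Finset.sum_eq_zero fun i hi => ?_
    rw [if_neg (by simpa using hi), mul_zero]
  | succ m hm ih =>
    rw [Finset.sum_range_succ, ih, if_pos hm]
    ring

lemma baseDemand_eq {n k : ℕ} {x : Price} (hk : k ≤ n + 1)
    (h : ∀ i : Fin (n + 1), x ≤ gridValue n i ↔ k ≤ i) : baseDemand n x = baseTail n k := by
  simp only [baseDemand, h]
  rw [Fin.sum_univ_eq_sum_range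
    (fun i => (baseTail n i - baseTail n (i + 1)) * if k ≤ i then 1 else 0),
    sum_range_sub_mul_ite _ hk, baseTail_of_lt (Nat.lt_succ_self n), sub_zero]

lemma mul_baseDemand_le (n : ℕ) (x : Price) : x * baseDemand n x ≤ 1 / 4 := by
  obtain ⟨k, hk, h⟩ := exists_le_gridValue_iff n x
  rw [baseDemand_eq hk h]
  rcases hk.eq_or_lt with rfl | hk
  · rw [baseTail_of_lt (Nat.lt_succ_self n)]
    norm_num
  · have hx : (x : ℝ) ≤ gridValue n ⟨k, hk⟩ := (h ⟨k, hk⟩).2 le_rfl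
    rw [← gridValue_mul_baseTail ⟨k, hk⟩]
    have := baseTail_ge (Nat.lt_succ_iff.1 hk)
    exact mul_le_mul_of_nonneg_right hx (by linarith)

lemma baseDemand_mem (n : ℕ) (x : Price) : 0 ≤ baseDemand n x ∧ baseDemand n x ≤ 1 := by
  obtain ⟨k, hk, h⟩ := exists_le_gridValue_iff n x
  rw [baseDemand_eq hk h]
  rcases hk.eq_or_lt with rfl | hk
  · norm_num [baseTail_of_lt]
  · have h1 := baseTail_ge (Nat.lt_succ_iff.1 hk)
    refine ⟨by linarith, ?_⟩
    rcases Nat.eq_zero_or_pos k with rfl | h0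
    · rw [baseTail_zero]
    · have := baseTail_le h0 (Nat.lt_succ_iff.1 hk)
      have h3 : (0 : ℝ) < 1 / (2 * ((n : ℝ) + 1)) := by positivity
      linarith

/-! ### Cells and shifted instances -/

/-- The indicator function of the prices between the values `j` and `j + 1`. -/
noncomputable def cell (n : ℕ) (j : Fin n) (x : Price) : ℝ :=
  if gridValue n j.castSucc < x ∧ x ≤ gridValue n j.succ then 1 else 0

lemma cell_eq_zero_or_one {n : ℕ} (j : Fin n) (x : Price) : cell n j x = 0 ∨ cell n j x = 1 := by
  unfold cell
  split_ifs <;> simp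

lemma cell_nonneg {n : ℕ} (j : Fin n) (x : Price) : 0 ≤ cell n j x := by
  rcases cell_eq_zero_or_one j x with h | h <;> simp [h]

lemma cell_le_one {n : ℕ} (j : Fin n) (x : Price) : cell n j x ≤ 1 := by
  rcases cell_eq_zero_or_one j x with h | h <;> simp [h]

lemma cell_ne_zero {n : ℕ} {j : Fin n} {x : Price} (h : cell n j x ≠ 0) :
    gridValue n j.castSucc < x ∧ x ≤ gridValue n j.succ := by
  by_contra h'
  exact h (if_neg h')

lemma cell_succ {n : ℕ} (j : Fin n) : cell n j (gridValue n j.succ) = 1 :=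
  if_pos ⟨gridValue_strictMono n j.castSucc_lt_succ, le_rfl⟩

lemma sum_cell_le_one (n : ℕ) (x : Price) : ∑ j, cell n j x ≤ 1 := by
  by_cases h : ∃ j, cell n j x ≠ 0
  · obtain ⟨j, hj⟩ := h
    rw [Finset.sum_eq_single_of_mem j (Finset.mem_univ j)]
    · exact cell_le_one j x
    · intro i _ hij
      by_contra hi
      have h1 := cell_ne_zero hi
      have h2 := cell_ne_zero hj
      have h3 := (gridValue_strictMono n).lt_iff_lt.1 (h1.1.trans_le h2.2)
      have h4 := (gridValue_strictMono n).lt_iff_lt.1 (h2.1.trans_le h1.2)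
      simp only [Fin.lt_def, Fin.val_castSucc, Fin.val_succ] at h3 h4
      exact hij (Fin.ext (by omega))
  · push Not at h
    simp [h]

lemma baseDemand_of_cell {n : ℕ} {j : Fin n} {x : Price} (h : cell n j x ≠ 0) :
    baseDemand n x = baseTail n (j + 1) := by
  obtain ⟨h1, h2⟩ := cell_ne_zero h
  refine baseDemand_eq (by omega) fun i => ⟨fun hx => ?_, fun hi => h2.trans ?_⟩
  · exact (gridValue_strictMono n).lt_iff_lt.1 (h1.trans_le hx)
  · exact (gridValue_strictMono n).monotone hi

/-- The instance obtained from the base distribution by moving the mass `ε` from the value `j`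
to the value `j + 1`. -/
noncomputable def shiftedInstance {n : ℕ} {ε : ℝ} (h0 : 0 < ε) (h1 : ε < 1 / (2 * ((n : ℝ) + 1)))
    (j : Fin n) : Instance (n + 1) where
  v := gridValue n
  p i := baseTail n i - baseTail n (i + 1)
    + ε * ((if i = j.succ then 1 else 0) - if i = j.castSucc then 1 else 0)
  v_strictMono := gridValue_strictMono n
  p_pos i := by
    have := baseTail_sub_ge (Nat.lt_succ_iff.1 i.isLt)
    split_ifs <;> linarith
  p_sum := by
    rw [Finset.sum_add_distrib, ← Finset.mul_sum,
      Fin.sum_univ_eq_sum_range (fun i => baseTail n i - baseTail n (i + 1)),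
      Finset.sum_range_sub', baseTail_zero, baseTail_of_lt (Nat.lt_succ_self n),
      Finset.sum_sub_distrib]
    simp

section shiftedInstance

variable {n : ℕ} {ε : ℝ} (h0 : 0 < ε) (h1 : ε < 1 / (2 * ((n : ℝ) + 1))) (j : Fin n)

/-- The moved mass changes its answer only at prices above value `j` and not above value `j + 1`. -/
lemma shiftedInstance_demand (x : Price) :
    (shiftedInstance h0 h1 j).demand x = baseDemand n x + ε * cell n j x := by
  simp only [Instance.demand, shiftedInstance, baseDemand, cell, add_mul, mul_assoc]
  rw [Finset.sum_add_distrib, ← Finset.mul_sum]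
  congr 2
  simp only [sub_mul, ite_mul, one_mul, zero_mul]
  rw [Finset.sum_sub_distrib, Finset.sum_ite_eq' Finset.univ, Finset.sum_ite_eq' Finset.univ]
  have hv := gridValue_strictMono n j.castSucc_lt_succ
  simp only [Finset.mem_univ, if_true]
  by_cases ha : x ≤ gridValue n j.castSucc
  · simp [ha, ha.trans hv.le]
  · by_cases hb : x ≤ gridValue n j.succ <;> simp [ha, hb, not_le.1 ha]

lemma shiftedInstance_demand_mem (x : Price) :
    0 ≤ (shiftedInstance h0 h1 j).demand x ∧ (shiftedInstance h0 h1 j).demand x ≤ 1 := by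
  constructor
  · exact Finset.sum_nonneg fun i _ => mul_nonneg ((shiftedInstance h0 h1 j).p_pos i).le
      (by split_ifs <;> norm_num)
  · rw [← (shiftedInstance h0 h1 j).p_sum]
    refine Finset.sum_le_sum fun i _ => mul_le_of_le_one_right
      ((shiftedInstance h0 h1 j).p_pos i).le (by split_ifs <;> norm_num)

lemma baseDemand_log_le (x : Price) (a b : ℝ) (ha : 0 < a) (hb : 0 < b) :
    baseDemand n x * Real.log a + (1 - baseDemand n x) * Real.log b
      ≤ 16 / 3 * ε ^ 2 * cell n j x
        + Real.log ((shiftedInstance h0 h1 j).demand x * a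
          + (1 - (shiftedInstance h0 h1 j).demand x) * b) := by
  rw [shiftedInstance_demand]
  by_cases hc : cell n j x = 0
  · rw [hc, mul_zero, mul_zero, add_zero, zero_add]
    exact mul_log_add_mul_log_le_self (baseDemand_mem n x).1 (baseDemand_mem n x).2 ha hb
  · rw [(cell_eq_zero_or_one j x).resolve_left hc, baseDemand_of_cell hc]
    have h2 := baseTail_ge (n := n) (i := j + 1) j.isLt
    have h3 := baseTail_le (n := n) (i := j + 1) (by omega) j.isLt
    set p := baseTail n (j + 1)
    refine (mul_log_add_mul_log_le (q := p + ε * 1) (by linarith) (by linarith) (by linarith)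
      (by linarith) ha hb).trans (add_le_add_left ?_ _)
    rw [div_le_iff₀ (mul_pos (by linarith) (by linarith))]
    -- Both `p` and `p + ε` lie in `[1/4, 3/4]`: the gap `1 / (2 * (n + 1))` in `baseTail_le`
    -- absorbs `ε`.
    have h4 : 3 / 16 ≤ (p + ε * 1) * (1 - (p + ε * 1)) := by nlinarith
    have h5 := mul_le_mul_of_nonneg_left h4 (show 0 ≤ 16 / 3 * ε ^ 2 by positivity)
    linarith

/-- A round earns at most 1/4 in expectation outside the cell, and at most `gridValue n j.succ * ε`
more inside it. So revenue minus that bonus per cell visit has drift at most 1/4. -/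
lemma stepOp_pow_totalRevenue_le (f : DeterministicSeller) (T : ℕ) :
    (stepOp f (shiftedInstance h0 h1 j).demand ^ T) totalRevenue []
      ≤ T * (1 / 4) + gridValue n j.succ * ε
        * (stepOp f (shiftedInstance h0 h1 j).demand ^ T) (totalWeight (cell n j)) [] := by
  set d := (shiftedInstance h0 h1 j).demand with hd
  set g := (gridValue n j.succ : ℝ) * ε
  have key := stepOp_pow_le_add_mul f (d := d) (fun x => (shiftedInstance_demand_mem h0 h1 j x).1)
    (fun x => (shiftedInstance_demand_mem h0 h1 j x).2)
    (G := totalRevenue - g • totalWeight (cell n j)) (a := 1 / 4) (fun h => by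
      simp only [map_sub, map_smul, Pi.sub_apply, Pi.smul_apply, smul_eq_mul,
        stepOp_totalRevenue, stepOp_totalWeight]
      have hb := mul_baseDemand_le n (f.post h)
      have hc : f.post h * (ε * cell n j (f.post h)) ≤ g * cell n j (f.post h) := by
        by_cases hc : cell n j (f.post h) = 0
        · simp [hc]
        · have hx : (f.post h : ℝ) ≤ gridValue n j.succ := (cell_ne_zero hc).2
          rw [← mul_assoc]
          exact mul_le_mul_of_nonneg_right (mul_le_mul_of_nonneg_right hx h0.le)
            (cell_nonneg j (f.post h))
      rw [hd, shiftedInstance_demand]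
      linarith) T []
  simp only [map_sub, map_smul, Pi.sub_apply, Pi.smul_apply, smul_eq_mul, totalRevenue_nil,
    totalWeight_nil] at key
  linarith

lemma expect_regret_shiftedInstance_ge (f : DeterministicSeller) (T : ℕ) :
    gridValue n j.succ * ε * (T
        - (stepOp f (shiftedInstance h0 h1 j).demand ^ T) (totalWeight (cell n j)) [])
      ≤ (shiftedInstance h0 h1 j).expect (fun V : Fin T → Price =>
        ∑ t, revenue (gridValue n j.succ) (V t) - ∑ t, revenue (f.price V t) (V t)) := by
  rw [expect_regret, shiftedInstance_demand, cell_succ,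
    baseDemand_of_cell (j := j) (by rw [cell_succ]; norm_num)]
  have h2 := stepOp_pow_totalRevenue_le h0 h1 j f T
  have h3 := gridValue_mul_baseTail j.succ
  rw [Fin.val_succ] at h3
  have h4 : (gridValue n j.succ : ℝ) * (baseTail n (j + 1) + ε * 1)
      = 1 / 4 + gridValue n j.succ * ε := by
    rw [← h3]
    ring
  rw [h4]
  linarith

end shiftedInstance

/-! ### Averaging over the instances -/

lemma sum_stepOp_pow_totalWeight_cell_le (f : DeterministicSeller) (n T : ℕ) :
    ∑ j, (stepOp f (baseDemand n) ^ T) (totalWeight (cell n j)) [] ≤ T := by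
  have key := stepOp_pow_le_add_mul f (d := baseDemand n) (fun x => (baseDemand_mem n x).1)
    (fun x => (baseDemand_mem n x).2) (G := ∑ j, totalWeight (cell n j)) (a := 1) (fun h => by
      simp only [map_sum, Finset.sum_apply, stepOp_totalWeight, Finset.sum_add_distrib]
      linarith [sum_cell_le_one n (f.post h)]) T []
  simpa [map_sum, Finset.sum_apply] using key

/-- The lower bound on the average regret of a deterministic seller. -/
lemma sum_expect_regret_ge {n T : ℕ} (hn : 2 ≤ n) (hT : 0 < T) {ε : ℝ} (h0 : 0 < ε)
    (h1 : ε < 1 / (2 * ((n : ℝ) + 1))) (hε : ε ^ 2 * T = (n + 1) / 576)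
    (f : DeterministicSeller) :
    ε * T * (19 / 216) * n ≤ ∑ j, (shiftedInstance h0 h1 j).expect (fun V : Fin T → Price =>
        ∑ t, revenue (gridValue n j.succ) (V t) - ∑ t, revenue (f.price V t) (V t)) := by
  have hT' : (0 : ℝ) < T := by exact_mod_cast hT
  have hn' : (2 : ℝ) ≤ n := by exact_mod_cast hn
  set N : Fin n → ℝ := fun j => (stepOp f (baseDemand n) ^ T) (totalWeight (cell n j)) []
  have hN : ∑ j, N j ≤ T := sum_stepOp_pow_totalWeight_cell_le f n T
  have hj : ∀ j, ε * T / 3 * (7 / 8 - (1 / T + 128 / 3 * ε ^ 2) * N j)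
      ≤ (shiftedInstance h0 h1 j).expect (fun V : Fin T → Price =>
        ∑ t, revenue (gridValue n j.succ) (V t) - ∑ t, revenue (f.price V t) (V t)) := by
    intro j
    refine le_trans ?_ (expect_regret_shiftedInstance_ge h0 h1 j f T)
    have hm := shiftedInstance_demand_mem h0 h1 j
    -- The choice `l = 1 / 8` yields `7 / 8 = 1 - l` and `128 / 3 = (16 / 3) / l`.
    have key := one_sub_stepOp_pow_totalWeight_ge f (fun x => (baseDemand_mem n x).1)
      (fun x => (baseDemand_mem n x).2) (fun x => (hm x).1) (fun x => (hm x).2)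
      (cell_nonneg j) (cell_le_one j) (baseDemand_log_le h0 h1 j) hT (l := 1 / 8)
      (by norm_num) (by norm_num)
    have hle := stepOp_pow_mono f (fun x => (hm x).1) (fun x => (hm x).2)
      (G := totalWeight (cell n j)) (G' := fun _ => (T : ℝ)) T [] fun h hh => by
        have := totalWeight_le_length (cell_le_one j) h
        rw [hh] at this
        simpa using this
    rw [stepOp_pow_const] at hle
    set B := (stepOp f (shiftedInstance h0 h1 j).demand ^ T) (totalWeight (cell n j)) []
    have e1 : (T : ℝ) - B = T * (1 - B / T) := by
      field_simp
    have hv := gridValue_succ_ge j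
    calc ε * T / 3 * (7 / 8 - (1 / T + 128 / 3 * ε ^ 2) * N j)
        = 1 / 3 * ε * (T * ((1 - N j / T) - 1 / 8 - 16 / 3 * ε ^ 2 / (1 / 8) * N j)) := by ring
      _ ≤ 1 / 3 * ε * (T * (1 - B / T)) := by gcongr
      _ = 1 / 3 * ε * (T - B) := by rw [e1]
      _ ≤ gridValue n j.succ * ε * (T - B) := by
        have := sub_nonneg.2 hle
        gcongr
  refine le_trans ?_ (Finset.sum_le_sum fun j _ => hj j)
  rw [← Finset.mul_sum, Finset.sum_sub_distrib, ← Finset.mul_sum]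
  simp only [Finset.sum_const, Finset.card_univ, Fintype.card_fin, nsmul_eq_mul]
  have h3 : (1 / T + 128 / 3 * ε ^ 2) * ∑ j, N j ≤ 1 + 2 / 27 * (n + 1) := by
    calc (1 / T + 128 / 3 * ε ^ 2) * ∑ j, N j ≤ (1 / T + 128 / 3 * ε ^ 2) * T := by gcongr
      _ = 1 + 128 / 3 * (ε ^ 2 * T) := by
        field_simp
      _ = 1 + 2 / 27 * (n + 1) := by
        rw [hε]
        ring
  calc ε * T * (19 / 216) * n = ε * T / 3 * (19 / 72 * n) := by ring
    _ ≤ _ := by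
      gcongr
      -- The claim `19/72 * n ≤ 7/8 * n - 1 - 2/27 * (n + 1)` is equivalent to `n ≥ 2`, with
      -- equality at `n = 2`.
      linarith

/-! ### Boundedness and measurability for randomized sellers -/

lemma abs_revenue_le_one (x w : Price) : |revenue x w| ≤ 1 := by
  unfold revenue
  split_ifs
  · rw [abs_of_nonneg x.2.1]
    exact x.2.2
  · simp

lemma abs_expect_le {K : ℕ} (I : Instance K) {T : ℕ} {g : (Fin T → Price) → ℝ} {C : ℝ}
    (hg : ∀ V, |g V| ≤ C) : |I.expect g| ≤ C := by
  have hw : ∀ i : Fin T → Fin K, 0 ≤ ∏ t, I.p (i t) := fun i =>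
    Finset.prod_nonneg fun t _ => (I.p_pos _).le
  have hsum : ∑ i : Fin T → Fin K, ∏ t, I.p (i t) = 1 := by
    rw [← Fintype.piFinset_univ, Finset.sum_prod_piFinset Finset.univ fun _ a => I.p a]
    simp [I.p_sum]
  calc |I.expect g| ≤ ∑ i : Fin T → Fin K, |(∏ t, I.p (i t)) * g (fun t => I.v (i t))| :=
        Finset.abs_sum_le_sum_abs _ _
    _ ≤ ∑ i : Fin T → Fin K, (∏ t, I.p (i t)) * C := by
        gcongr with i
        rw [abs_mul, abs_of_nonneg (hw i)]
        exact mul_le_mul_of_nonneg_left (hg _) (hw i)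
    _ = C := by rw [← Finset.sum_mul, hsum, one_mul]

lemma abs_expect_regret_le {K : ℕ} (I : Instance K) (T : ℕ) (f : DeterministicSeller) (x : Price) :
    |I.expect (fun V : Fin T → Price =>
      ∑ t, revenue x (V t) - ∑ t, revenue (f.price V t) (V t))| ≤ 2 * T := by
  refine abs_expect_le I fun V => ?_
  rw [← Finset.sum_sub_distrib]
  refine (Finset.abs_sum_le_sum_abs _ _).trans ?_
  refine (Finset.sum_le_card_nsmul _ _ 2 fun t _ => ?_).trans_eq (by simp [mul_comm])
  have h1 := abs_revenue_le_one x (V t)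
  have h2 := abs_revenue_le_one (f.price V t) (V t)
  exact (abs_sub _ _).trans (by linarith)

lemma measurable_price {T : ℕ} (V : Fin T → Price) (t : Fin T) :
    Measurable fun f : DeterministicSeller => f.price V t :=
  Measurable.of_comap_le <| le_iSup_of_le T <| le_iSup_of_le V <|
    le_iSup (fun t : Fin T => MeasurableSpace.comap
      (fun f : DeterministicSeller => f.price V t) inferInstance) t

lemma measurable_revenue (w : Price) : Measurable fun x => revenue x w :=
  Measurable.ite (measurableSet_le measurable_subtype_coe measurable_const)
    measurable_subtype_coe measurable_const

lemma integrable_expect_regret {K : ℕ} (I : Instance K) (T : ℕ) (S : Measure DeterministicSeller)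
    [IsProbabilityMeasure S] (x : Price) :
    Integrable (fun f => I.expect (fun V : Fin T → Price =>
      ∑ t, revenue x (V t) - ∑ t, revenue (f.price V t) (V t))) S := by
  refine Integrable.of_bound (C := 2 * T) ?_ (ae_of_all _ fun f => abs_expect_regret_le I T f x)
  refine Measurable.aestronglyMeasurable ?_
  unfold Instance.expect
  refine Finset.measurable_sum _ fun i _ => Measurable.const_mul (Measurable.const_sub ?_ _) _
  exact Finset.measurable_sum _ fun t _ => (measurable_revenue _).comp (measurable_price _ t)

/-- The uniform bound `2 * T` is essential: a real supremum over an unbounded family would default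
to zero. -/
lemma regretAgainst_le_regret {K : ℕ} (I : Instance K) (T : ℕ) (S : Measure DeterministicSeller)
    [IsProbabilityMeasure S] (x : Price) : regretAgainst I T S x ≤ regret I T S := by
  refine le_ciSup (f := regretAgainst I T S) ⟨2 * T, ?_⟩ x
  rintro _ ⟨y, rfl⟩
  have := integral_mono (integrable_expect_regret I T S y) (integrable_const (2 * (T : ℝ)))
    fun f => (abs_le.1 (abs_expect_regret_le I T f y)).2
  simpa [regretAgainst] using this

end DynamicPricing

theorem theorem1 (K T : ℕ) (hK : 3 ≤ K) (hT : K ^ 3 ≤ T) :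
    ∃ (v : Fin K → DynamicPricing.Price) (m : ℕ) (I : Fin m → DynamicPricing.Instance K),
      0 < m ∧ (∀ j, (I j).v = v) ∧
      ∀ S : MeasureTheory.Measure DynamicPricing.DeterministicSeller,
        MeasureTheory.IsProbabilityMeasure S →
        (∃ j, 1 / 375 * Real.sqrt ((K : ℝ) * T) ≤ DynamicPricing.regret (I j) T S) ∧
        1 / 375 * Real.sqrt ((K : ℝ) * T) ≤
          (∑ j, DynamicPricing.regret (I j) T S) / m := by
  obtain ⟨n, rfl⟩ : ∃ n, K = n + 1 := ⟨K - 1, by omega⟩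
  have hn : 2 ≤ n := by omega
  have hT0 : 0 < T := lt_of_lt_of_le (by positivity) hT
  have hTr : (0 : ℝ) < T := by exact_mod_cast hT0
  have hTK : ((n : ℝ) + 1) ^ 3 ≤ T := by exact_mod_cast hT
  set R := Real.sqrt (((n + 1 : ℕ) : ℝ) * T) with hR
  have hR0 : 0 < R := Real.sqrt_pos.2 (by positivity)
  have hR2 : R ^ 2 = (n + 1) * T := by
    rw [hR, Real.sq_sqrt (by positivity)]
    push_cast
    ring
  -- This is the shift `ε = √(K / T) / 24`.
  have h0 : 0 < R / (24 * T) := by positivity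
  have h1 : R / (24 * T) < 1 / (2 * ((n : ℝ) + 1)) := by
    rw [div_lt_div_iff₀ (by positivity) (by positivity)]
    -- This is where `K ^ 3 ≤ T` enters: it keeps `ε` below every base mass.
    have : R * (n + 1) ≤ T := by
      have hsq : (R * ((n : ℝ) + 1)) ^ 2 ≤ (T : ℝ) ^ 2 := by
        rw [mul_pow, hR2]
        have := mul_le_mul_of_nonneg_right hTK hTr.le
        linarith
      exact (pow_le_pow_iff_left₀ (by positivity) hTr.le two_ne_zero).1 hsq
    linarith
  have hε : (R / (24 * T)) ^ 2 * T = (n + 1) / 576 := by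
    rw [div_pow, hR2]
    field_simp
    norm_num
  refine ⟨DynamicPricing.gridValue n, n, DynamicPricing.shiftedInstance h0 h1, by omega,
    fun _ => rfl, fun S hS => ?_⟩
  have hn0 : (0 : ℝ) < n := by
    have : 0 < n := by omega
    exact_mod_cast this
  have key : 1 / 375 * R * n
      ≤ ∑ j, DynamicPricing.regret (DynamicPricing.shiftedInstance h0 h1 j) T S := by
    refine le_trans ?_ (Finset.sum_le_sum fun j _ =>
      DynamicPricing.regretAgainst_le_regret _ T S (DynamicPricing.gridValue n j.succ))
    unfold DynamicPricing.regretAgainst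
    rw [← integral_finsetSum _ fun j _ => DynamicPricing.integrable_expect_regret _ T S _]
    have hint := integral_mono (integrable_const _)
      (integrable_finsetSum Finset.univ fun j _ => DynamicPricing.integrable_expect_regret
        (DynamicPricing.shiftedInstance h0 h1 j) T S (DynamicPricing.gridValue n j.succ))
      (DynamicPricing.sum_expect_regret_ge hn hT0 h0 h1 hε)
    rw [integral_const, probReal_univ, one_smul] at hint
    refine le_trans ?_ hint
    have e : R / (24 * T) * T = R / 24 := by
      field_simp
    rw [e]
    -- Numerically, `19 / (216 * 24) ≥ 1 / 375`.
    exact mul_le_mul_of_nonneg_right (by linarith) hn0.le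
  refine ⟨?_, (le_div_iff₀ hn0).2 key⟩
  by_contra! hlt
  have : Nonempty (Fin n) := ⟨⟨0, by omega⟩⟩
  have hs := Finset.sum_lt_sum_of_nonempty Finset.univ_nonempty fun j (_ : j ∈ Finset.univ) => hlt j
  rw [Finset.sum_const, Finset.card_univ, Fintype.card_fin, nsmul_eq_mul] at hs
  linarith
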